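/- **Contract language.** Expressions are $e ::= \mathsf{obs}(l,i)\mid r\mid b\mid op(e_1,\dots,e_n)\mid x\mid \mathsf{acc}(\lambda x.e_1,k,e_2)$ (with $i\in\mathbb Z$, $r\in\mathbb R$, $b$ a Boolean, $k\in\mathbb N$; operations are negation, not, $+,-,\cdot,/,<,\le,=$, and, or, and the conditional $\mathsf{cond}$; division is totalised by $x/0=0$). Template expressions are $t::=n\mid v$, a numeral or a template variable. Contracts are $$c ::= \mathsf{zero}\mid \mathsf{let}\ x=e\ \mathsf{in}\ c\mid \mathsf{transfer}(p,q,a)\mid \mathsf{scale}(e,c)\mid \mathsf{translate}(t,c)\mid \mathsf{both}(c_1,c_2)\mid \mathsf{ifWithin}(e,t,c_1,c_2).$$ A contract is template-closed if it contains no template variable. Every label has type Real or Bool, $\Gamma$ assigns types to variables, and $\Gamma\vdash c$ is the evident simple typing: scaling factors are real, conditions Boolean. An external environment $\rho'$ maps each $(l,i)$, $i\in\mathbb Z$, to a value in $\mathbb R\cup\mathbb B$; it is well-typed if this value has the type of $l$; $(\rho'/n)(l,i)=\rho'(l,i+n)$. A partial external environment is a partial such map. **Semantics.** $\mathcal E[\![e]\!]_{\gamma,\rho'}$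 is the usual partial evaluation ($\mathsf{obs}(l,i)$ denotes $\rho'(l,i)$; $\mathsf{acc}(\lambda x.e_1,0,e_2)$ denotes $e_2$, and $\mathsf{acc}(\lambda x.e_1,k+1,e_2)$ denotes $e_1$ with $x$ bound to the value of $\mathsf{acc}(\lambda x.e_1,k,e_2)$ in $\rho'/(-1)$). $\mathcal C[\![c]\!]_{\gamma,\rho',\delta}$, when defined, is a trace $\mathrm{tr}:\mathbb N\to(\mathrm{Party}\times\mathrm{Party}\times\mathrm{Asset}\to\mathbb R)$: $\mathsf{zero}$ has the zero trace; $\mathsf{transfer}(p,q,a)$ has at time $0$ the values $1$ at $(p,q,a)$ and $-1$ at $(q,p,a)$ if $p\ne q$, and is zero otherwise; $\mathsf{let}$, $\mathsf{scale}$, $\mathsf{both}$ bind, multiply and add; $\mathsf{translate}(t,c)$ is the trace of $c$ in $\rho'/n$ delayed by $n=[\![t]\!]_\delta$; $\mathsf{ifWithin}(e,t,c_1,c_2)$ is the trace of $c_1$ if $e$ is true now; if $e$ is false it is the trace of $c_2$ when $[\![t]\!]_\delta=0$, and otherwise the trace, in $\rho'/1$ and delayed by $1$, of the same conditional with window $[\![t]\!]_\delta-1$.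 Write $\mathrm{tr}(s)(p,q)=\sum_a \mathrm{tr}(s)(p,q,a)$. The horizon is $\mathrm{HOR}_\delta(\mathsf{zero})=0$, $\mathrm{HOR}_\delta(\mathsf{transfer}(p,q,a))=1$, that of $c$ for $\mathsf{let}\ x=e\ \mathsf{in}\ c$ and $\mathsf{scale}(e,c)$, $[\![t]\!]_\delta\oplus\mathrm{HOR}_\delta(c)$ for $\mathsf{translate}$, the maximum for $\mathsf{both}$, and $[\![t]\!]_\delta\oplus\max(\mathrm{HOR}_\delta(c_1),\mathrm{HOR}_\delta(c_2))$ for $\mathsf{ifWithin}$, where $m\oplus 0=0$ and $m\oplus h=m+h$ for $h>0$. **Reduction.** Let $\gamma_0$ be a partial variable assignment and $\rho$ a partial external environment. Let $\mathrm{sp}(e)$ be $e$ with the variables and observables known in $\gamma_0,\rho$ replaced by literals and constants folded (including the shortcuts for $\mathsf{and}$, $\mathsf{or}$, $\mathsf{cond}$), and let $\hat e$ be $\mathrm{sp}(e)$ with all observable offsets decreased by $1$. $c\Rightarrow^T_\rho c'$ is generated by: - $\mathsf{zero}\Rightarrow^{0}\mathsf{zero}$; $\ \mathsf{transfer}(p,q,a)\Rightarrow^{T}\mathsf{zero}$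 with $T$ the transfer at time $0$ above; - if $c\Rightarrow^T c'$ and $\mathrm{sp}(e)$ is a real literal $r$, then $\mathsf{scale}(e,c)\Rightarrow^{rT}\mathsf{scale}(\hat e,c')$; if $c\Rightarrow^0 c'$ and $\mathrm{sp}(e)$ is not a literal, then $\mathsf{scale}(e,c)\Rightarrow^{0}\mathsf{scale}(\hat e,c')$; - $\mathsf{let}\ x=e\ \mathsf{in}\ c\Rightarrow^T\mathsf{let}\ x=\hat e\ \mathsf{in}\ c'$ if $c\Rightarrow^T c'$, where $x$ is known in the premise exactly if $\mathrm{sp}(e)$ is a literal, with that value; - $\mathsf{translate}(0,c)\Rightarrow^T c'$ if $c\Rightarrow^T c'$; $\ \mathsf{translate}(n+1,c)\Rightarrow^0\mathsf{translate}(n,c)$; - $\mathsf{both}(c_1,c_2)\Rightarrow^{T_1+T_2}\mathsf{both}(c_1',c_2')$ if $c_i\Rightarrow^{T_i}c_i'$; - $\mathsf{ifWithin}(e,n,c_1,c_2)\Rightarrow^T c_1'$ if $\mathrm{sp}(e)=\mathrm{true}$ and $c_1\Rightarrow^T c_1'$; if $\mathrm{sp}(e)=\mathrm{false}$: $\mathsf{ifWithin}(e,0,c_1,c_2)\Rightarrow^T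 c_2'$ when $c_2\Rightarrow^Tc_2'$, and $\mathsf{ifWithin}(e,n+1,c_1,c_2)\Rightarrow^0\mathsf{ifWithin}(e,n,c_1,c_2)$. **Payoff language.** Payoff expressions consist of literals, template expressions $t$ (numerals, template variables, sums), $\mathsf{now}$, $\mathsf{model}(l,t)$ (where $t$ may also contain integers), $\mathsf{if}$, $\mathsf{loopif}$, $\mathsf{payoff}(t,p,q)$ and unary and binary operations. The partial semantics $[\![il]\!]_{\rho',\delta,t_0,t,d,p_1,p_2}\in\mathbb N\cup\mathbb R\cup\mathbb B$ interprets $\mathsf{now}$ as $t$, a template expression $t^e$ as $[\![t^e]\!]_\delta+t_0$, $\mathsf{model}(l,t^e)$ as $\rho'(l,[\![t^e]\!]_\delta+t_0)$, $\mathsf{payoff}(t^e,p,q)$ as $d([\![t^e]\!]_\delta+t_0)$ if $(p,q)=(p_1,p_2)$, as $-d([\![t^e]\!]_\delta+t_0)$ if $(p,q)=(p_2,p_1)$ and as $0$ otherwise, and $\mathsf{loopif}(il_0,il_1,il_2,t^e)$ as the value of $il_1$ at the first of the shifts $t_0,\dots,t_0+[\![t^e]\!]_\delta$ at which $il_0$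 is true and, if $il_0$ is false at all of them, that of $il_2$ at the last; the other constructs are interpreted as usual. Compilation $\tau[\![\cdot]\!]_{t_0}$ maps $\mathsf{obs}(l,i)$ to $\mathsf{model}(l,t_0+i)$, $\mathsf{cond}$ to $\mathsf{if}$, $\mathsf{zero}$ to $0$, $\mathsf{transfer}(p,q,a)$ to $\mathsf{payoff}(t_0,p,q)$, $\mathsf{scale}$ and $\mathsf{both}$ to product and sum, $\mathsf{translate}(t,c)$ to $\tau[\![c]\!]_{t_0+t}$ (with the sum of two numerals computed at once), $\mathsf{ifWithin}(e,t,c_1,c_2)$ to $\mathsf{loopif}(\tau[\![e]\!]_{t_0},\tau[\![c_1]\!]_{t_0},\tau[\![c_2]\!]_{t_0},t)$, keeps literals and operations, and is undefined on variables, $\mathsf{acc}$ and $\mathsf{let}$. $\mathsf{cutPayoff}$ replaces every $\mathsf{payoff}(t,p,q)$ by $\mathsf{if}(t<\mathsf{now},0,\mathsf{payoff}(t,p,q))$. **Theorem.** Let $p_1\neq p_2$ be parties, $d:\mathbb N\to\mathbb R$ a discount function, $\rho'$ a well-typed external environment, $\delta$ a template environment, $\gamma\in[\![\Gamma]\!]$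 a variable assignment extending $\gamma_0$. Let $c$ be a template-closed contract with $\Gamma\vdash c$ and $\tau[\![c]\!]_0=il$. 1. If $\rho'$ extends the partial external environment $\rho$, $c\Rightarrow^T_\rho c'$ for some $T$, and $\mathcal C[\![c']\!]_{\gamma,\rho'/1,\delta}=\mathrm{trace}$, then $[\![\mathsf{cutPayoff}(il)]\!]_{\rho',\delta,0,1,d,p_1,p_2}$ is defined and $$\sum_{t'=0}^{\mathrm{HOR}_\delta(c')} d(t'+1)\cdot \mathrm{trace}(t')(p_1,p_2) = [\![\mathsf{cutPayoff}(il)]\!]_{\rho',\delta,0,1,d,p_1,p_2}.$$ 2. More generally, let $n\in\mathbb N$ and let $\rho_0,\dots,\rho_{n-1}$ be partial external environments such that $\rho'/i$ extends $\rho_i$ for each $i<n$. If $c=c_0\Rightarrow_{\rho_0}c_1\Rightarrow_{\rho_1}\cdots\Rightarrow_{\rho_{n-1}}c_n=c'$ (each step with some transfer) and $\mathcal C[\![c']\!]_{\gamma,\rho'/n,\delta}=\mathrm{trace}$, then $[\![\mathsf{cutPayoff}(il)]\!]_{\rho',\delta,0,n,d,p_1,p_2}$ is defined and $$\sum_{t'=0}^{\mathrm{HOR}_\delta(c')}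 d(t'+n)\cdot \mathrm{trace}(t')(p_1,p_2) = [\![\mathsf{cutPayoff}(il)]\!]_{\rho',\delta,0,n,d,p_1,p_2}.$$ -/

import Mathlib

noncomputable section

namespace CL

/-! ## Values, types and primitive operations -/

/-- Types of expressions. -/
inductive Ty where
  | real
  | bool

/-- Values of expressions: elements of `ℝ ∪ 𝔹`. -/
inductive Val where
  | real (r : ℝ)
  | bool (b : Bool)

/-- `v.HasTy τ` means `v ∈ ⟦τ⟧`, where `⟦Real⟧ = ℝ` and `⟦Bool⟧ = 𝔹`. -/
inductive Val.HasTy : Val → Ty → Prop where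
  | real (r : ℝ) : Val.HasTy (.real r) .real
  | bool (b : Bool) : Val.HasTy (.bool b) .bool

inductive UnOp where
  | neg | not

inductive BinOp where
  | add | sub | mult | div | lt | leq | eq | and | or

/-- Meaning of unary operations (undefined on arguments of the wrong type). -/
def UnOp.sem : UnOp → Val → Option Val
  | .neg, .real x => some (.real (-x))
  | .not, .bool b => some (.bool (!b))
  | _, _ => none

/-- Meaning of binary operations (undefined on arguments of the wrong type). -/
def BinOp.sem : BinOp → Val → Val → Option Val
  | .add, .real x, .real y => some (.real (x + y))
  | .sub, .real x, .real y => some (.real (x - y))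
  | .mult, .real x, .real y => some (.real (x * y))
  | .div, .real x, .real y => some (.real (x / y))
  | .lt, .real x, .real y => some (.bool (decide (x < y)))
  | .leq, .real x, .real y => some (.bool (decide (x ≤ y)))
  | .eq, .real x, .real y => some (.bool (decide (x = y)))
  | .and, .bool a, .bool b => some (.bool (a && b))
  | .or, .bool a, .bool b => some (.bool (a || b))
  | _, _, _ => none

/-- Typing of unary operations: argument type, result type. -/
inductive UnOp.HasTy : UnOp → Ty → Ty → Prop where
  | neg : UnOp.HasTy .neg .real .real
  | not : UnOp.HasTy .not .bool .bool

/-- Typing of binary operations: type of both arguments, result type. -/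
inductive BinOp.HasTy : BinOp → Ty → Ty → Prop where
  | add : BinOp.HasTy .add .real .real
  | sub : BinOp.HasTy .sub .real .real
  | mult : BinOp.HasTy .mult .real .real
  | div : BinOp.HasTy .div .real .real
  | lt : BinOp.HasTy .lt .real .bool
  | leq : BinOp.HasTy .leq .real .bool
  | eq : BinOp.HasTy .eq .real .bool
  | and : BinOp.HasTy .and .bool .bool
  | or : BinOp.HasTy .or .bool .bool

/-! ## Syntax of the contract language -/

/-- Names of expression variables. -/
abbrev Var := ℕ

/-- Expressions over observable labels `Label`.  Besides operations, observables and literals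
there are variables and the accumulation construct `acc(λx. f, d, e)`; the latter two are not
supported by the compiler. -/
inductive Exp (Label : Type*) where
  | obs (l : Label) (i : ℤ)
  | real (r : ℝ)
  | bool (b : Bool)
  | un (o : UnOp) (e : Exp Label)
  | bin (o : BinOp) (e₁ e₂ : Exp Label)
  | cond (b e₁ e₂ : Exp Label)
  | var (x : Var)
  | acc (x : Var) (f : Exp Label) (d : ℕ) (e : Exp Label)

/-- Template expressions: numerals and template variables. -/
inductive TExpr (TVar : Type*) where
  | num (n : ℕ)
  | var (v : TVar)

/-- Contracts. `letin x e c` is `let x = e in c`. -/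
inductive Contr (Label Party Asset TVar : Type*) where
  | zero
  | letin (x : Var) (e : Exp Label) (c : Contr Label Party Asset TVar)
  | transfer (p q : Party) (a : Asset)
  | scale (e : Exp Label) (c : Contr Label Party Asset TVar)
  | translate (t : TExpr TVar) (c : Contr Label Party Asset TVar)
  | both (c₁ c₂ : Contr Label Party Asset TVar)
  | ifWithin (e : Exp Label) (t : TExpr TVar) (c₁ c₂ : Contr Label Party Asset TVar)

/-! ## Environments -/

/-- External environments. -/
abbrev Env (Label : Type*) := Label → ℤ → Val

/-- Partial external environments. -/
abbrev PEnv (Label : Type*) := Label → ℤ → Option Val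

/-- Template environments. -/
abbrev TEnv (TVar : Type*) := TVar → ℕ

/-- Variable assignments: partial mappings from variable names to values. -/
abbrev VEnv := Var → Option Val

/-- Typing contexts for variables. -/
abbrev TyCtx := Var → Option Ty

/-- `ρ/k`: the (total or partial) external environment `ρ` advanced by `k` time steps. -/
def shift {Label V : Type*} (k : ℤ) (ρ : Label → ℤ → V) : Label → ℤ → V :=
  fun l i => ρ l (i + k)

/-- Every observable has a value of the type of its label. -/
def Env.WellTyped {Label : Type*} (σ : Label → Ty) (ρ : Env Label) : Prop :=
  ∀ l i, (ρ l i).HasTy (σ l)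

/-- The environment `ρ'` extends the partial environment `ρ`. -/
def Env.Extends {Label : Type*} (ρ' : Env Label) (ρ : PEnv Label) : Prop :=
  ∀ l i v, ρ l i = some v → ρ' l i = v

/-- `γ ∈ ⟦Γ⟧`: the variables in the domain of `Γ` have values of their type, and no other
variable has a value. -/
def VEnv.WellTyped (Γ : TyCtx) (γ : VEnv) : Prop :=
  ∀ x, Option.Rel Val.HasTy (γ x) (Γ x)

/-- The assignment `γ` extends the assignment `γ₀`. -/
def VEnv.Extends (γ γ₀ : VEnv) : Prop :=
  ∀ x v, γ₀ x = some v → γ x = some v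

/-! ## Typing and template-closedness -/

/-- `Γ ⊢ e : τ`, where the label `l` has type `σ l`. -/
inductive Exp.HasTy {Label : Type*} (σ : Label → Ty) : TyCtx → Exp Label → Ty → Prop where
  | obs (Γ : TyCtx) (l : Label) (i : ℤ) : Exp.HasTy σ Γ (.obs l i) (σ l)
  | real (Γ : TyCtx) (r : ℝ) : Exp.HasTy σ Γ (.real r) .real
  | bool (Γ : TyCtx) (b : Bool) : Exp.HasTy σ Γ (.bool b) .bool
  | un {Γ : TyCtx} {o : UnOp} {e : Exp Label} {τ τ' : Ty} :
      o.HasTy τ τ' → Exp.HasTy σ Γ e τ → Exp.HasTy σ Γ (.un o e) τ'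
  | bin {Γ : TyCtx} {o : BinOp} {e₁ e₂ : Exp Label} {τ τ' : Ty} :
      o.HasTy τ τ' → Exp.HasTy σ Γ e₁ τ → Exp.HasTy σ Γ e₂ τ → Exp.HasTy σ Γ (.bin o e₁ e₂) τ'
  | cond {Γ : TyCtx} {b e₁ e₂ : Exp Label} {τ : Ty} :
      Exp.HasTy σ Γ b .bool → Exp.HasTy σ Γ e₁ τ → Exp.HasTy σ Γ e₂ τ →
      Exp.HasTy σ Γ (.cond b e₁ e₂) τ
  | var {Γ : TyCtx} {x : Var} {τ : Ty} : Γ x = some τ → Exp.HasTy σ Γ (.var x) τ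
  | acc {Γ : TyCtx} {x : Var} {f e : Exp Label} {d : ℕ} {τ : Ty} :
      Exp.HasTy σ (Function.update Γ x (some τ)) f τ → Exp.HasTy σ Γ e τ →
      Exp.HasTy σ Γ (.acc x f d e) τ

/-- `Γ ⊢ c`: the contract `c` is well-typed. -/
inductive Contr.WellTyped {Label Party Asset TVar : Type*} (σ : Label → Ty) :
    TyCtx → Contr Label Party Asset TVar → Prop where
  | zero (Γ : TyCtx) : Contr.WellTyped σ Γ .zero
  | letin {Γ : TyCtx} {x : Var} {e : Exp Label} {c : Contr Label Party Asset TVar} {τ : Ty} :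
      e.HasTy σ Γ τ → Contr.WellTyped σ (Function.update Γ x (some τ)) c →
      Contr.WellTyped σ Γ (.letin x e c)
  | transfer (Γ : TyCtx) (p q : Party) (a : Asset) : Contr.WellTyped σ Γ (.transfer p q a)
  | scale {Γ : TyCtx} {e : Exp Label} {c : Contr Label Party Asset TVar} :
      e.HasTy σ Γ .real → Contr.WellTyped σ Γ c → Contr.WellTyped σ Γ (.scale e c)
  | translate {Γ : TyCtx} (t : TExpr TVar) {c : Contr Label Party Asset TVar} :
      Contr.WellTyped σ Γ c → Contr.WellTyped σ Γ (.translate t c)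
  | both {Γ : TyCtx} {c₁ c₂ : Contr Label Party Asset TVar} :
      Contr.WellTyped σ Γ c₁ → Contr.WellTyped σ Γ c₂ → Contr.WellTyped σ Γ (.both c₁ c₂)
  | ifWithin {Γ : TyCtx} {e : Exp Label} (t : TExpr TVar) {c₁ c₂ : Contr Label Party Asset TVar} :
      e.HasTy σ Γ .bool → Contr.WellTyped σ Γ c₁ → Contr.WellTyped σ Γ c₂ →
      Contr.WellTyped σ Γ (.ifWithin e t c₁ c₂)

/-- Contracts without template variables. -/
inductive Contr.TemplateClosed {Label Party Asset TVar : Type*} :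
    Contr Label Party Asset TVar → Prop where
  | zero : Contr.TemplateClosed .zero
  | letin (x : Var) (e : Exp Label) {c : Contr Label Party Asset TVar} :
      Contr.TemplateClosed c → Contr.TemplateClosed (.letin x e c)
  | transfer (p q : Party) (a : Asset) : Contr.TemplateClosed (.transfer p q a)
  | scale (e : Exp Label) {c : Contr Label Party Asset TVar} :
      Contr.TemplateClosed c → Contr.TemplateClosed (.scale e c)
  | translate (n : ℕ) {c : Contr Label Party Asset TVar} :
      Contr.TemplateClosed c → Contr.TemplateClosed (.translate (.num n) c)
  | both {c₁ c₂ : Contr Label Party Asset TVar} :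
      Contr.TemplateClosed c₁ → Contr.TemplateClosed c₂ → Contr.TemplateClosed (.both c₁ c₂)
  | ifWithin (e : Exp Label) (n : ℕ) {c₁ c₂ : Contr Label Party Asset TVar} :
      Contr.TemplateClosed c₁ → Contr.TemplateClosed c₂ →
      Contr.TemplateClosed (.ifWithin e (.num n) c₁ c₂)

/-! ## Denotational semantics of the contract language -/

/-- `d`-fold accumulation ending at the current time: `z` is evaluated `d` steps in the past,
and `f` is then applied at each of the `d` following times. -/
def accSem {Label V : Type*} (f : Val → (Label → ℤ → V) → Option Val)
    (z : (Label → ℤ → V) → Option Val) : ℕ → (Label → ℤ → V) → Option Val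
  | 0, ρ => z ρ
  | d + 1, ρ => (accSem f z d (shift (-1) ρ)).bind fun v => f v ρ

/-- The conditional on values. -/
def condSem : Val → Val → Val → Option Val
  | .bool b, .real x, .real y => some (.real (if b then x else y))
  | .bool b, .bool x, .bool y => some (.bool (if b then x else y))
  | _, _, _ => none

/-- Semantics of expressions. -/
def Exp.sem {Label : Type*} : Exp Label → VEnv → Env Label → Option Val
  | .obs l i, _, ρ => some (ρ l i)
  | .real r, _, _ => some (.real r)
  | .bool b, _, _ => some (.bool b)
  | .un o e, γ, ρ => (e.sem γ ρ).bind o.sem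
  | .bin o e₁ e₂, γ, ρ => (e₁.sem γ ρ).bind fun v₁ => (e₂.sem γ ρ).bind fun v₂ => o.sem v₁ v₂
  | .cond b e₁ e₂, γ, ρ =>
      (b.sem γ ρ).bind fun v => (e₁.sem γ ρ).bind fun v₁ => (e₂.sem γ ρ).bind fun v₂ =>
        condSem v v₁ v₂
  | .var x, γ, _ => γ x
  | .acc x f d e, γ, ρ =>
      accSem (fun v ρ => f.sem (Function.update γ x (some v)) ρ) (fun ρ => e.sem γ ρ) d ρ

/-- Semantics of template expressions. -/
def TExpr.sem {TVar : Type*} (δ : TEnv TVar) : TExpr TVar → ℕ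
  | .num n => n
  | .var v => δ v

/-- Transfers: the amount of each asset flowing from one party to another. -/
abbrev Transfers (Party Asset : Type*) := Party → Party → Asset → ℝ

/-- Traces: the transfers at each time. -/
abbrev Trace (Party Asset : Type*) := ℕ → Transfers Party Asset

open Classical in
/-- The transfer of one unit of asset `a` from `p` to `q` (no transfer if `p = q`). -/
def Transfers.single {Party Asset : Type*} (p q : Party) (a : Asset) : Transfers Party Asset :=
  fun p' q' a' =>
    if p = q then 0
    else if p' = p ∧ q' = q ∧ a' = a then 1
    else if p' = q ∧ q' = p ∧ a' = a then -1
    else 0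

/-- The aggregate amount, over all assets, flowing from `p` to `q`. -/
def Transfers.total {Party Asset : Type*} (T : Transfers Party Asset) (p q : Party) : ℝ :=
  ∑ᶠ a, T p q a

/-- The trace with transfer `T` at time `0` and no other transfer. -/
def Trace.now {Party Asset : Type*} (T : Transfers Party Asset) : Trace Party Asset :=
  fun t => if t = 0 then T else 0

/-- The trace `tr` delayed by `n` time steps. -/
def Trace.delay {Party Asset : Type*} (n : ℕ) (tr : Trace Party Asset) : Trace Party Asset :=
  fun t => if t < n then 0 else tr (t - n)

/-- Semantics of `ifWithin` from the semantics of its condition and of its branches. -/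
def withinSem {Label Party Asset : Type*} (b : Env Label → Option Val)
    (k₁ k₂ : Env Label → Option (Trace Party Asset)) :
    ℕ → Env Label → Option (Trace Party Asset)
  | 0, ρ =>
      match b ρ with
      | some (.bool true) => k₁ ρ
      | some (.bool false) => k₂ ρ
      | _ => none
  | n + 1, ρ =>
      match b ρ with
      | some (.bool true) => k₁ ρ
      | some (.bool false) => (withinSem b k₁ k₂ n (shift 1 ρ)).map (Trace.delay 1)
      | _ => none

/-- Semantics of contracts. -/
def Contr.sem {Label Party Asset TVar : Type*} :
    Contr Label Party Asset TVar → VEnv → Env Label → TEnv TVar → Option (Trace Party Asset)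
  | .zero, _, _, _ => some 0
  | .letin x e c, γ, ρ, δ => (e.sem γ ρ).bind fun v => c.sem (Function.update γ x (some v)) ρ δ
  | .transfer p q a, _, _, _ => some (Trace.now (Transfers.single p q a))
  | .scale e c, γ, ρ, δ =>
      match e.sem γ ρ with
      | some (.real r) => (c.sem γ ρ δ).map fun tr => r • tr
      | _ => none
  | .translate t c, γ, ρ, δ =>
      (c.sem γ (shift (t.sem δ : ℤ) ρ) δ).map (Trace.delay (t.sem δ))
  | .both c₁ c₂, γ, ρ, δ =>
      (c₁.sem γ ρ δ).bind fun tr₁ => (c₂.sem γ ρ δ).map fun tr₂ => tr₁ + tr₂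
  | .ifWithin e t c₁ c₂, γ, ρ, δ =>
      withinSem (fun ρ => e.sem γ ρ) (fun ρ => c₁.sem γ ρ δ) (fun ρ => c₂.sem γ ρ δ) (t.sem δ) ρ

/-- Adds a delay to a horizon; an empty contract stays empty when delayed. -/
def plus0 (n h : ℕ) : ℕ := if h = 0 then 0 else n + h

/-- The symbolic horizon `HOR_δ(c)`: no transfer takes place at time `HOR_δ(c)` or later. -/
def Contr.horizon {Label Party Asset TVar : Type*} (δ : TEnv TVar) :
    Contr Label Party Asset TVar → ℕ
  | .zero => 0
  | .letin _ _ c => c.horizon δ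
  | .transfer _ _ _ => 1
  | .scale _ c => c.horizon δ
  | .translate t c => plus0 (t.sem δ) (c.horizon δ)
  | .both c₁ c₂ => max (c₁.horizon δ) (c₂.horizon δ)
  | .ifWithin _ t c₁ c₂ => plus0 (t.sem δ) (max (c₁.horizon δ) (c₂.horizon δ))

/-! ## Contract reduction -/

/-- The literal denoting a value. -/
def Exp.ofVal {Label : Type*} : Val → Exp Label
  | .real r => .real r
  | .bool b => .bool b

/-- The value of a literal. -/
def Exp.lit? {Label : Type*} : Exp Label → Option Val
  | .real r => some (.real r)
  | .bool b => some (.bool b)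
  | _ => none

/-- Constant folding for a unary operation. -/
def Exp.foldUn {Label : Type*} (o : UnOp) (e : Exp Label) : Exp Label :=
  match e.lit?.bind o.sem with
  | some v => .ofVal v
  | none => .un o e

/-- Constant folding for a binary operation, with the usual shortcuts for `and` and `or`. -/
def Exp.foldBin {Label : Type*} : BinOp → Exp Label → Exp Label → Exp Label
  | .and, .bool true, e => e
  | .and, .bool false, _ => .bool false
  | .and, e, .bool true => e
  | .and, _, .bool false => .bool false
  | .or, .bool true, _ => .bool true
  | .or, .bool false, e => e
  | .or, _, .bool true => .bool true
  | .or, e, .bool false => e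
  | o, e₁, e₂ =>
      match e₁.lit?.bind fun v₁ => e₂.lit?.bind fun v₂ => o.sem v₁ v₂ with
      | some v => .ofVal v
      | none => .bin o e₁ e₂

/-- Constant folding for the conditional. -/
def Exp.foldCond {Label : Type*} : Exp Label → Exp Label → Exp Label → Exp Label
  | .bool true, e₁, _ => e₁
  | .bool false, _, e₂ => e₂
  | b, e₁, e₂ => .cond b e₁ e₂

/-- Specialisation of an expression with respect to a partial variable assignment and a partial
external environment: known variables and observables are replaced by literals, and constant
expressions are evaluated. -/
def Exp.specialise {Label : Type*} : Exp Label → VEnv → PEnv Label → Exp Label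
  | .obs l i, _, ρ =>
      match ρ l i with
      | some v => .ofVal v
      | none => .obs l i
  | .real r, _, _ => .real r
  | .bool b, _, _ => .bool b
  | .un o e, γ, ρ => .foldUn o (e.specialise γ ρ)
  | .bin o e₁ e₂, γ, ρ => .foldBin o (e₁.specialise γ ρ) (e₂.specialise γ ρ)
  | .cond b e₁ e₂, γ, ρ =>
      .foldCond (b.specialise γ ρ) (e₁.specialise γ ρ) (e₂.specialise γ ρ)
  | .var x, γ, _ =>
      match γ x with
      | some v => .ofVal v
      | none => .var x
  | .acc x f d e, γ, ρ =>
      match accSem (fun v ρ => (f.specialise (Function.update γ x (some v)) ρ).lit?)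
          (fun ρ => (e.specialise γ ρ).lit?) d ρ with
      | some v => .ofVal v
      | none =>
          .acc x (f.specialise (Function.update γ x none) (fun _ _ => none)) d
            (e.specialise γ (shift (-(d : ℤ)) ρ))

/-- Translation in time: all observables are looked up `k` steps later. -/
def Exp.promote {Label : Type*} (k : ℤ) : Exp Label → Exp Label
  | .obs l i => .obs l (i + k)
  | .real r => .real r
  | .bool b => .bool b
  | .un o e => .un o (e.promote k)
  | .bin o e₁ e₂ => .bin o (e₁.promote k) (e₂.promote k)
  | .cond b e₁ e₂ => .cond (b.promote k) (e₁.promote k) (e₂.promote k)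
  | .var x => .var x
  | .acc x f d e => .acc x (f.promote k) d (e.promote k)

/-- The reduction relation: `Red γ ρ c T c'` means that in one time step the contract `c`
evolves to `c'` with transfers `T`, given the known values `γ` of variables and `ρ` of
observables. -/
inductive Red {Label Party Asset TVar : Type*} :
    VEnv → PEnv Label → Contr Label Party Asset TVar → Transfers Party Asset →
      Contr Label Party Asset TVar → Prop where
  | zero (γ : VEnv) (ρ : PEnv Label) : Red γ ρ .zero 0 .zero
  | letin {γ : VEnv} {ρ : PEnv Label} {x : Var} {e : Exp Label}
      {c c' : Contr Label Party Asset TVar} {T : Transfers Party Asset} :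
      Red (Function.update γ x (e.specialise γ ρ).lit?) ρ c T c' →
      Red γ ρ (.letin x e c) T (.letin x ((e.specialise γ ρ).promote (-1)) c')
  | transfer (γ : VEnv) (ρ : PEnv Label) (p q : Party) (a : Asset) :
      Red γ ρ (.transfer p q a) (Transfers.single p q a) .zero
  | scale {γ : VEnv} {ρ : PEnv Label} {e : Exp Label} {r : ℝ}
      {c c' : Contr Label Party Asset TVar} {T : Transfers Party Asset} :
      (e.specialise γ ρ).lit? = some (.real r) → Red γ ρ c T c' →
      Red γ ρ (.scale e c) (r • T) (.scale ((e.specialise γ ρ).promote (-1)) c')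
  | scale_unknown {γ : VEnv} {ρ : PEnv Label} {e : Exp Label}
      {c c' : Contr Label Party Asset TVar} :
      (e.specialise γ ρ).lit? = none → Red γ ρ c 0 c' →
      Red γ ρ (.scale e c) 0 (.scale ((e.specialise γ ρ).promote (-1)) c')
  | translate_zero {γ : VEnv} {ρ : PEnv Label}
      {c c' : Contr Label Party Asset TVar} {T : Transfers Party Asset} :
      Red γ ρ c T c' → Red γ ρ (.translate (.num 0) c) T c'
  | translate_succ (γ : VEnv) (ρ : PEnv Label) (n : ℕ) (c : Contr Label Party Asset TVar) :
      Red γ ρ (.translate (.num (n + 1)) c) 0 (.translate (.num n) c)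
  | both {γ : VEnv} {ρ : PEnv Label}
      {c₁ c₁' c₂ c₂' : Contr Label Party Asset TVar} {T₁ T₂ : Transfers Party Asset} :
      Red γ ρ c₁ T₁ c₁' → Red γ ρ c₂ T₂ c₂' → Red γ ρ (.both c₁ c₂) (T₁ + T₂) (.both c₁' c₂')
  | if_true {γ : VEnv} {ρ : PEnv Label} {e : Exp Label} {n : ℕ}
      {c₁ c₁' c₂ : Contr Label Party Asset TVar} {T : Transfers Party Asset} :
      (e.specialise γ ρ).lit? = some (.bool true) → Red γ ρ c₁ T c₁' →
      Red γ ρ (.ifWithin e (.num n) c₁ c₂) T c₁'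
  | if_false_zero {γ : VEnv} {ρ : PEnv Label} {e : Exp Label}
      {c₁ c₂ c₂' : Contr Label Party Asset TVar} {T : Transfers Party Asset} :
      (e.specialise γ ρ).lit? = some (.bool false) → Red γ ρ c₂ T c₂' →
      Red γ ρ (.ifWithin e (.num 0) c₁ c₂) T c₂'
  | if_false_succ {γ : VEnv} {ρ : PEnv Label} {e : Exp Label} {n : ℕ}
      {c₁ c₂ : Contr Label Party Asset TVar} :
      (e.specialise γ ρ).lit? = some (.bool false) →
      Red γ ρ (.ifWithin e (.num (n + 1)) c₁ c₂) 0 (.ifWithin e (.num n) c₁ c₂)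

/-- `n`-step reduction. `ρs i` is the partial external environment, relative to time `i`, that is
used in the step from time `i` to time `i + 1`. -/
inductive RedN {Label Party Asset TVar : Type*} (γ : VEnv) (ρs : ℕ → PEnv Label)
    (c : Contr Label Party Asset TVar) : ℕ → Contr Label Party Asset TVar → Prop where
  | refl : RedN γ ρs c 0 c
  | step {n : ℕ} {c' c'' : Contr Label Party Asset TVar} {T : Transfers Party Asset} :
      RedN γ ρs c n c' → Red γ (ρs n) c' T c'' → RedN γ ρs c (n + 1) c''

/-! ## The payoff intermediate language -/

/-- Template expressions with addition. -/
inductive ILTExpr (TVar : Type*) where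
  | texpr (t : TExpr TVar)
  | tplus (t₁ t₂ : ILTExpr TVar)

/-- Template expressions with addition and integer literals. -/
inductive ILTExprZ (TVar : Type*) where
  | texpr (t : ILTExpr TVar)
  | int (i : ℤ)
  | tplus (t₁ t₂ : ILTExprZ TVar)

/-- Payoff expressions. -/
inductive ILExpr (Label Party TVar : Type*) where
  | now
  | nat (n : ℕ)
  | real (r : ℝ)
  | bool (b : Bool)
  | texpr (t : ILTExpr TVar)
  | model (l : Label) (t : ILTExprZ TVar)
  | ite (b e₁ e₂ : ILExpr Label Party TVar)
  | loopif (b e₁ e₂ : ILExpr Label Party TVar) (t : TExpr TVar)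
  | payoff (t : ILTExpr TVar) (p q : Party)
  | un (o : UnOp) (e : ILExpr Label Party TVar)
  | bin (o : BinOp) (e₁ e₂ : ILExpr Label Party TVar)

/-- Values of payoff expressions: elements of `ℕ ∪ ℝ ∪ 𝔹`. -/
inductive ILVal where
  | nat (n : ℕ)
  | val (v : Val)

def ILTExpr.sem {TVar : Type*} (δ : TEnv TVar) : ILTExpr TVar → ℕ
  | .texpr t => t.sem δ
  | .tplus t₁ t₂ => t₁.sem δ + t₂.sem δ

def ILTExprZ.sem {TVar : Type*} (δ : TEnv TVar) : ILTExprZ TVar → ℤ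
  | .texpr t => (t.sem δ : ℤ)
  | .int i => i
  | .tplus t₁ t₂ => t₁.sem δ + t₂.sem δ

/-- Unary operations on values of payoff expressions. -/
def UnOp.ilSem : UnOp → ILVal → Option ILVal
  | o, .val v => (o.sem v).map .val
  | _, _ => none

/-- Binary operations on values of payoff expressions; natural numbers can be compared. -/
def BinOp.ilSem : BinOp → ILVal → ILVal → Option ILVal
  | o, .val v₁, .val v₂ => (o.sem v₁ v₂).map .val
  | .lt, .nat m, .nat n => some (.val (.bool (decide (m < n))))
  | _, _, _ => none

/-- Semantics of `loopif` from the semantics of its condition and of its branches, as functions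
of the time shift. -/
def loopSem (b k₁ k₂ : ℕ → Option ILVal) : ℕ → ℕ → Option ILVal
  | 0, t₀ =>
      match b t₀ with
      | some (.val (.bool true)) => k₁ t₀
      | some (.val (.bool false)) => k₂ t₀
      | _ => none
  | n + 1, t₀ =>
      match b t₀ with
      | some (.val (.bool true)) => k₁ t₀
      | some (.val (.bool false)) => loopSem b k₁ k₂ n (t₀ + 1)
      | _ => none

open Classical in
/-- Semantics of payoff expressions: `e.sem ρ δ t₀ t d p₁ p₂` with time shift `t₀`, current time
`t`, discount function `d`, and payoffs from `p₁` to `p₂` counted as positive. -/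
def ILExpr.sem {Label Party TVar : Type*} (ρ : Env Label) (δ : TEnv TVar) (t₀ t : ℕ)
    (d : ℕ → ℝ) (p₁ p₂ : Party) : ILExpr Label Party TVar → Option ILVal
  | .now => some (.nat t)
  | .nat n => some (.nat n)
  | .real r => some (.val (.real r))
  | .bool b => some (.val (.bool b))
  | .texpr te => some (.nat (te.sem δ + t₀))
  | .model l te => some (.val (ρ l (te.sem δ + t₀)))
  | .ite b e₁ e₂ =>
      match b.sem ρ δ t₀ t d p₁ p₂ with
      | some (.val (.bool true)) => e₁.sem ρ δ t₀ t d p₁ p₂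
      | some (.val (.bool false)) => e₂.sem ρ δ t₀ t d p₁ p₂
      | _ => none
  | .loopif b e₁ e₂ te =>
      loopSem (fun t₀' => b.sem ρ δ t₀' t d p₁ p₂) (fun t₀' => e₁.sem ρ δ t₀' t d p₁ p₂)
        (fun t₀' => e₂.sem ρ δ t₀' t d p₁ p₂) (te.sem δ) t₀
  | .payoff te p q =>
      some (.val (.real
        (if p = p₁ ∧ q = p₂ then d (te.sem δ + t₀)
        else if p = p₂ ∧ q = p₁ then -d (te.sem δ + t₀)
        else 0)))
  | .un o e => (e.sem ρ δ t₀ t d p₁ p₂).bind o.ilSem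
  | .bin o e₁ e₂ =>
      (e₁.sem ρ δ t₀ t d p₁ p₂).bind fun v₁ => (e₂.sem ρ δ t₀ t d p₁ p₂).bind fun v₂ =>
        o.ilSem v₁ v₂

/-! ## Compilation and `cutPayoff` -/

/-- Addition of template expressions that adds numerals right away. -/
def smartTplus {TVar : Type*} : ILTExpr TVar → ILTExpr TVar → ILTExpr TVar
  | .texpr (.num m), .texpr (.num n) => .texpr (.num (m + n))
  | t₁, t₂ => .tplus t₁ t₂

/-- Compilation of expressions at starting time `t₀`; undefined on variables and `acc`. -/
def Exp.compile {Label : Type*} (Party : Type*) {TVar : Type*} (t₀ : ILTExpr TVar) :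
    Exp Label → Option (ILExpr Label Party TVar)
  | .obs l i => some (.model l (.tplus (.texpr t₀) (.int i)))
  | .real r => some (.real r)
  | .bool b => some (.bool b)
  | .un o e => (e.compile Party t₀).map fun il => .un o il
  | .bin o e₁ e₂ =>
      (e₁.compile Party t₀).bind fun il₁ => (e₂.compile Party t₀).map fun il₂ => .bin o il₁ il₂
  | .cond b e₁ e₂ =>
      (b.compile Party t₀).bind fun il => (e₁.compile Party t₀).bind fun il₁ =>
        (e₂.compile Party t₀).map fun il₂ => .ite il il₁ il₂
  | .var _ => none
  | .acc _ _ _ _ => none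

/-- Compilation of contracts at starting time `t₀`; undefined on `let`. -/
def Contr.compile {Label Party Asset TVar : Type*} :
    Contr Label Party Asset TVar → ILTExpr TVar → Option (ILExpr Label Party TVar)
  | .zero, _ => some (.real 0)
  | .letin _ _ _, _ => none
  | .transfer p q _, t₀ => some (.payoff t₀ p q)
  | .scale e c, t₀ =>
      (e.compile Party t₀).bind fun il₁ => (c.compile t₀).map fun il₂ => .bin .mult il₁ il₂
  | .translate t c, t₀ => c.compile (smartTplus t₀ (.texpr t))
  | .both c₁ c₂, t₀ =>
      (c₁.compile t₀).bind fun il₁ => (c₂.compile t₀).map fun il₂ => .bin .add il₁ il₂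
  | .ifWithin e t c₁ c₂, t₀ =>
      (e.compile Party t₀).bind fun il => (c₁.compile t₀).bind fun il₁ =>
        (c₂.compile t₀).map fun il₂ => .loopif il il₁ il₂ t

/-- Guards every payoff so that it is dropped if it lies before the current time. -/
def ILExpr.cutPayoff {Label Party TVar : Type*} :
    ILExpr Label Party TVar → ILExpr Label Party TVar
  | .now => .now
  | .nat n => .nat n
  | .real r => .real r
  | .bool b => .bool b
  | .texpr t => .texpr t
  | .model l t => .model l t
  | .ite b e₁ e₂ => .ite b.cutPayoff e₁.cutPayoff e₂.cutPayoff
  | .loopif b e₁ e₂ t => .loopif b.cutPayoff e₁.cutPayoff e₂.cutPayoff t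
  | .payoff t p q => .ite (.bin .lt (.texpr t) .now) (.real 0) (.payoff t p q)
  | .un o e => .un o e.cutPayoff
  | .bin o e₁ e₂ => .bin o e₁.cutPayoff e₂.cutPayoff

end CL

end

open CL

namespace CL

/-! Compilation fails on variables, `acc` and `let`, so a well-typed contract that compiles is
ground: its meaning does not depend on any variable assignment, and it is defined in every
well-typed environment. This matters because only the reduct is assumed to have a trace, while
compilation speaks of the original contract; totality (`Contr.Ground.sem`) supplies the trace `tr`
of the latter.

Two independent facts are then combined. By `Red.sound`, iterated in `RedN.sound`, each reduction
step removes the first entry of the trace, so the reduct after `n` steps has trace `tr (· + n)`. By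
`Contr.Ground.compile_sound`, the compiled expression with cut payoffs evaluates at current time `n`
to the sum over all times `t ≥ n` of `d t` times the net flow of `tr` at `t`. Reindexing this series
by `n` gives the trace of the reduct, and `Contr.sem_horizon` makes the series a finite sum.

The value of a trace is phrased as a `HasSum` over all times (`Trace.HasValue`). Subcontracts with
different horizons can then be added, and delays become changes of index, without any bookkeeping of
horizons. -/

/-- Typing of expressions without variables and accumulations. -/
inductive Exp.GroundTy {Label : Type*} (σ : Label → Ty) : Exp Label → Ty → Prop where
  | obs (l : Label) (i : ℤ) : Exp.GroundTy σ (.obs l i) (σ l)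
  | real (r : ℝ) : Exp.GroundTy σ (.real r) .real
  | bool (b : Bool) : Exp.GroundTy σ (.bool b) .bool
  | un {o : UnOp} {e : Exp Label} {τ τ' : Ty} :
      o.HasTy τ τ' → Exp.GroundTy σ e τ → Exp.GroundTy σ (.un o e) τ'
  | bin {o : BinOp} {e₁ e₂ : Exp Label} {τ τ' : Ty} :
      o.HasTy τ τ' → Exp.GroundTy σ e₁ τ → Exp.GroundTy σ e₂ τ → Exp.GroundTy σ (.bin o e₁ e₂) τ'
  | cond {b e₁ e₂ : Exp Label} {τ : Ty} :
      Exp.GroundTy σ b .bool → Exp.GroundTy σ e₁ τ → Exp.GroundTy σ e₂ τ →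
      Exp.GroundTy σ (.cond b e₁ e₂) τ

/-- Well-typed contracts without `let` whose expressions contain neither variables nor
accumulations. -/
inductive Contr.Ground {Label Party Asset TVar : Type*} (σ : Label → Ty) :
    Contr Label Party Asset TVar → Prop where
  | zero : Contr.Ground σ .zero
  | transfer (p q : Party) (a : Asset) : Contr.Ground σ (.transfer p q a)
  | scale {e : Exp Label} {c : Contr Label Party Asset TVar} :
      e.GroundTy σ .real → Contr.Ground σ c → Contr.Ground σ (.scale e c)
  | translate (t : TExpr TVar) {c : Contr Label Party Asset TVar} :
      Contr.Ground σ c → Contr.Ground σ (.translate t c)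
  | both {c₁ c₂ : Contr Label Party Asset TVar} :
      Contr.Ground σ c₁ → Contr.Ground σ c₂ → Contr.Ground σ (.both c₁ c₂)
  | ifWithin {e : Exp Label} (t : TExpr TVar) {c₁ c₂ : Contr Label Party Asset TVar} :
      e.GroundTy σ .bool → Contr.Ground σ c₁ → Contr.Ground σ c₂ →
      Contr.Ground σ (.ifWithin e t c₁ c₂)

variable {Label Party Asset TVar : Type*} {σ : Label → Ty}

/-! ## Environments -/

theorem shift_shift {V : Type*} (j k : ℤ) (ρ : Label → ℤ → V) :
    shift j (shift k ρ) = shift (j + k) ρ := by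
  funext l i
  simp [shift, add_assoc]

theorem shift_zero {V : Type*} (ρ : Label → ℤ → V) : shift 0 ρ = ρ := by
  funext l i
  simp [shift]

theorem Env.WellTyped.shift {ρ : Env Label} (h : ρ.WellTyped σ) (k : ℤ) :
    Env.WellTyped σ (CL.shift k ρ) :=
  fun l i => h l (i + k)

/-! ## Ground expressions -/

theorem Exp.GroundTy.of_compile {Γ : TyCtx} {e : Exp Label} {τ : Ty} (h : e.HasTy σ Γ τ)
    {t₀ : ILTExpr TVar} {il : ILExpr Label Party TVar} (hil : e.compile Party t₀ = some il) :
    e.GroundTy σ τ := by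
  induction h generalizing il with
  | obs Γ l i => exact .obs l i
  | real Γ r => exact .real r
  | bool Γ b => exact .bool b
  | un ho _ ih =>
    simp only [Exp.compile, Option.map_eq_some_iff] at hil
    obtain ⟨_, h, _⟩ := hil
    exact .un ho (ih h)
  | bin ho _ _ ih₁ ih₂ =>
    simp only [Exp.compile, Option.map_eq_some_iff, Option.bind_eq_some_iff] at hil
    obtain ⟨_, h₁, _, h₂, _⟩ := hil
    exact .bin ho (ih₁ h₁) (ih₂ h₂)
  | cond _ _ _ ih ih₁ ih₂ =>
    simp only [Exp.compile, Option.map_eq_some_iff, Option.bind_eq_some_iff] at hil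
    obtain ⟨_, h, _, h₁, _, h₂, _⟩ := hil
    exact .cond (ih h) (ih₁ h₁) (ih₂ h₂)
  | var _ => simp [Exp.compile] at hil
  | acc _ _ => simp [Exp.compile] at hil

theorem Contr.Ground.of_compile {Γ : TyCtx} {c : Contr Label Party Asset TVar}
    (h : c.WellTyped σ Γ) {t₀ : ILTExpr TVar} {il : ILExpr Label Party TVar}
    (hil : c.compile t₀ = some il) : c.Ground σ := by
  induction h generalizing t₀ il with
  | zero Γ => exact .zero
  | letin _ _ => simp [Contr.compile] at hil
  | transfer Γ p q a => exact .transfer p q a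
  | scale he _ ih =>
    simp only [Contr.compile, Option.map_eq_some_iff, Option.bind_eq_some_iff] at hil
    obtain ⟨_, h₁, _, h₂, _⟩ := hil
    exact .scale (.of_compile he h₁) (ih h₂)
  | translate t _ ih => exact .translate t (ih hil)
  | both _ _ ih₁ ih₂ =>
    simp only [Contr.compile, Option.map_eq_some_iff, Option.bind_eq_some_iff] at hil
    obtain ⟨_, h₁, _, h₂, _⟩ := hil
    exact .both (ih₁ h₁) (ih₂ h₂)
  | ifWithin t he _ _ ih₁ ih₂ =>
    simp only [Contr.compile, Option.map_eq_some_iff, Option.bind_eq_some_iff] at hil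
    obtain ⟨_, h, _, h₁, _, h₂, _⟩ := hil
    exact .ifWithin t (.of_compile he h) (ih₁ h₁) (ih₂ h₂)

theorem UnOp.HasTy.sem {o : UnOp} {τ τ' : Ty} (ho : o.HasTy τ τ') {v : Val} (hv : v.HasTy τ) :
    ∃ w, o.sem v = some w ∧ w.HasTy τ' := by
  cases ho <;> cases hv <;> exact ⟨_, rfl, by constructor⟩

theorem BinOp.HasTy.sem {o : BinOp} {τ τ' : Ty} (ho : o.HasTy τ τ') {v₁ v₂ : Val}
    (h₁ : v₁.HasTy τ) (h₂ : v₂.HasTy τ) : ∃ w, o.sem v₁ v₂ = some w ∧ w.HasTy τ' := by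
  cases ho <;> cases h₁ <;> cases h₂ <;> exact ⟨_, rfl, by constructor⟩

theorem condSem_of_hasTy {τ : Ty} {v₁ v₂ : Val} (b : Bool)
    (h₁ : v₁.HasTy τ) (h₂ : v₂.HasTy τ) :
    condSem (.bool b) v₁ v₂ = some (if b then v₁ else v₂) := by
  cases h₁ <;> cases h₂ <;> cases b <;> rfl

theorem Exp.GroundTy.sem {e : Exp Label} {τ : Ty} (h : e.GroundTy σ τ) (γ : VEnv)
    {ρ : Env Label} (hρ : ρ.WellTyped σ) : ∃ v, e.sem γ ρ = some v ∧ v.HasTy τ := by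
  induction h with
  | obs l i => exact ⟨_, rfl, hρ l i⟩
  | real r => exact ⟨_, rfl, .real r⟩
  | bool b => exact ⟨_, rfl, .bool b⟩
  | un ho _ ih =>
    obtain ⟨v, hv, hvt⟩ := ih
    simpa [Exp.sem, hv] using ho.sem hvt
  | bin ho _ _ ih₁ ih₂ =>
    obtain ⟨v₁, hv₁, ht₁⟩ := ih₁
    obtain ⟨v₂, hv₂, ht₂⟩ := ih₂
    simpa [Exp.sem, hv₁, hv₂] using ho.sem ht₁ ht₂
  | cond _ _ _ ih ih₁ ih₂ =>
    obtain ⟨v, hv, ht⟩ := ih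
    obtain ⟨v₁, hv₁, ht₁⟩ := ih₁
    obtain ⟨v₂, hv₂, ht₂⟩ := ih₂
    cases ht with
    | bool b =>
      refine ⟨_, by simp only [Exp.sem, hv, hv₁, hv₂, Option.bind_some]
                    exact condSem_of_hasTy b ht₁ ht₂, ?_⟩
      cases b <;> assumption

theorem Exp.GroundTy.promote {e : Exp Label} {τ : Ty} (h : e.GroundTy σ τ) (k : ℤ) :
    (e.promote k).GroundTy σ τ := by
  induction h with
  | obs l i => exact .obs l (i + k)
  | real r => exact .real r
  | bool b => exact .bool b
  | un ho _ ih => exact .un ho ih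
  | bin ho _ _ ih₁ ih₂ => exact .bin ho ih₁ ih₂
  | cond _ _ _ ih ih₁ ih₂ => exact .cond ih ih₁ ih₂

theorem Exp.GroundTy.sem_promote {e : Exp Label} {τ : Ty} (h : e.GroundTy σ τ) (k : ℤ) (γ : VEnv)
    (ρ : Env Label) : (e.promote k).sem γ ρ = e.sem γ (shift k ρ) := by
  induction h with
  | obs l i => rfl
  | real r => rfl
  | bool b => rfl
  | un ho _ ih => simp only [Exp.promote, Exp.sem, ih]
  | bin ho _ _ ih₁ ih₂ => simp only [Exp.promote, Exp.sem, ih₁, ih₂]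
  | cond _ _ _ ih ih₁ ih₂ => simp only [Exp.promote, Exp.sem, ih, ih₁, ih₂]

/-! ## Specialisation -/

theorem Exp.groundTy_ofVal {v : Val} {τ : Ty} (h : v.HasTy τ) :
    (Exp.ofVal v : Exp Label).GroundTy σ τ := by
  cases h <;> constructor

theorem Exp.sem_ofVal (v : Val) (γ : VEnv) (ρ : Env Label) :
    (Exp.ofVal v).sem γ ρ = some v := by
  cases v <;> rfl

theorem Exp.sem_of_lit? {e : Exp Label} {v : Val} (h : e.lit? = some v) (γ : VEnv)
    (ρ : Env Label) : e.sem γ ρ = some v := by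
  cases e <;> simp_all [Exp.lit?, Exp.sem]

theorem Exp.foldUn_sound {o : UnOp} {e : Exp Label} {τ : Ty}
    (h : (Exp.un o e).GroundTy σ τ) (γ : VEnv) {ρ : Env Label} (hρ : ρ.WellTyped σ) :
    (Exp.foldUn o e).GroundTy σ τ ∧ (Exp.foldUn o e).sem γ ρ = (Exp.un o e).sem γ ρ := by
  unfold Exp.foldUn
  split
  · next w hw =>
    obtain ⟨v, hv, hvw⟩ := Option.bind_eq_some_iff.1 hw
    have hs : (Exp.un o e).sem γ ρ = some w := by
      simp [Exp.sem, Exp.sem_of_lit? hv, hvw]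
    -- The literal has the right type because it is the value of a well-typed ground expression.
    obtain ⟨w', hw', ht⟩ := h.sem γ hρ
    obtain rfl : w = w' := by simpa [hs] using hw'
    exact ⟨groundTy_ofVal ht, by rw [sem_ofVal, hs]⟩
  · exact ⟨h, rfl⟩

/-- The shortcuts discard an operand that the semantics would still evaluate. They preserve meaning
only because a well-typed ground operand is always defined, which is why typing and meaning are
proved together. -/
theorem Exp.foldBin_sound {o : BinOp} {e₁ e₂ : Exp Label} {τ : Ty}
    (h : (Exp.bin o e₁ e₂).GroundTy σ τ) (γ : VEnv) {ρ : Env Label} (hρ : ρ.WellTyped σ) :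
    (Exp.foldBin o e₁ e₂).GroundTy σ τ ∧
      (Exp.foldBin o e₁ e₂).sem γ ρ = (Exp.bin o e₁ e₂).sem γ ρ := by
  have hb := h
  cases h with
  | bin ho h₁ h₂ =>
    obtain ⟨v₁, hv₁, ht₁⟩ := h₁.sem γ hρ
    obtain ⟨v₂, hv₂, ht₂⟩ := h₂.sem γ hρ
    unfold Exp.foldBin
    split
    case h_9 =>
      split
      · next w hw =>
        obtain ⟨u₁, hu₁, hw⟩ := Option.bind_eq_some_iff.1 hw
        obtain ⟨u₂, hu₂, hw⟩ := Option.bind_eq_some_iff.1 hw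
        have hs : (Exp.bin o e₁ e₂).sem γ ρ = some w := by
          simp [Exp.sem, Exp.sem_of_lit? hu₁, Exp.sem_of_lit? hu₂, hw]
        obtain ⟨w', hw', ht⟩ := hb.sem γ hρ
        obtain rfl : w = w' := by simpa [hs] using hw'
        exact ⟨groundTy_ofVal ht, by rw [sem_ofVal, hs]⟩
      · exact ⟨hb, rfl⟩
    all_goals
      -- In these eight shortcuts for `and` and `or` the result is always one of the two operands,
      -- hence Boolean; definedness of the other one settles the value.
      cases ho
      cases ht₁
      cases ht₂
      simp only [Exp.sem, Option.some.injEq, Val.bool.injEq] at hv₁ hv₂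
      refine ⟨by assumption, ?_⟩
      simp [Exp.sem, BinOp.sem, *]

theorem Exp.foldCond_sound {b e₁ e₂ : Exp Label} {τ : Ty}
    (h : (Exp.cond b e₁ e₂).GroundTy σ τ) (γ : VEnv) {ρ : Env Label} (hρ : ρ.WellTyped σ) :
    (Exp.foldCond b e₁ e₂).GroundTy σ τ ∧
      (Exp.foldCond b e₁ e₂).sem γ ρ = (Exp.cond b e₁ e₂).sem γ ρ := by
  have hb := h
  cases h with
  | cond h h₁ h₂ =>
    obtain ⟨v₁, hv₁, ht₁⟩ := h₁.sem γ hρ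
    obtain ⟨v₂, hv₂, ht₂⟩ := h₂.sem γ hρ
    unfold Exp.foldCond
    split
    · exact ⟨h₁, by simp [Exp.sem, hv₁, hv₂, condSem_of_hasTy _ ht₁ ht₂]⟩
    · exact ⟨h₂, by simp [Exp.sem, hv₁, hv₂, condSem_of_hasTy _ ht₁ ht₂]⟩
    · exact ⟨hb, rfl⟩

/-- The assignment `γ₀` used for specialising need not be related to the assignment `γ` used for
evaluation, since ground expressions have no variables to look up. -/
theorem Exp.GroundTy.specialise {e : Exp Label} {τ : Ty} (h : e.GroundTy σ τ) (γ γ₀ : VEnv)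
    {ρ' : Env Label} (hρ' : ρ'.WellTyped σ) {ρ : PEnv Label} (hρ : ρ'.Extends ρ) :
    (e.specialise γ₀ ρ).GroundTy σ τ ∧ (e.specialise γ₀ ρ).sem γ ρ' = e.sem γ ρ' := by
  induction h with
  | obs l i =>
    unfold Exp.specialise
    split
    · next v hv =>
      obtain rfl := hρ _ _ _ hv
      exact ⟨groundTy_ofVal (hρ' l i), sem_ofVal _ _ _⟩
    · exact ⟨.obs l i, rfl⟩
  | real r => exact ⟨.real r, rfl⟩
  | bool b => exact ⟨.bool b, rfl⟩
  | un ho _ ih =>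
    have := foldUn_sound (.un ho ih.1) γ hρ'
    exact ⟨this.1, this.2.trans (by simp only [Exp.sem, ih.2])⟩
  | bin ho _ _ ih₁ ih₂ =>
    have := foldBin_sound (.bin ho ih₁.1 ih₂.1) γ hρ'
    exact ⟨this.1, this.2.trans (by simp only [Exp.sem, ih₁.2, ih₂.2])⟩
  | cond _ _ _ ih ih₁ ih₂ =>
    have := foldCond_sound (.cond ih.1 ih₁.1 ih₂.1) γ hρ'
    exact ⟨this.1, this.2.trans (by simp only [Exp.sem, ih.2, ih₁.2, ih₂.2])⟩

/-! ## Traces -/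

theorem Trace.delay_add (n : ℕ) (tr : Trace Party Asset) (t : ℕ) :
    Trace.delay n tr (t + n) = tr t := by
  simp [Trace.delay]

theorem Trace.delay_zero (tr : Trace Party Asset) : Trace.delay 0 tr = tr := by
  funext t
  simp [Trace.delay]

/-! ### Horizons bound the support of traces in time. -/

theorem withinSem_horizon {b : Env Label → Option Val}
    {k₁ k₂ : Env Label → Option (Trace Party Asset)} {h : ℕ}
    (h₁ : ∀ ρ tr, k₁ ρ = some tr → ∀ t, h ≤ t → tr t = 0)
    (h₂ : ∀ ρ tr, k₂ ρ = some tr → ∀ t, h ≤ t → tr t = 0) (n : ℕ) (ρ : Env Label)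
    (tr : Trace Party Asset) (htr : withinSem b k₁ k₂ n ρ = some tr) (t : ℕ)
    (ht : plus0 n h ≤ t) : tr t = 0 := by
  induction n generalizing ρ tr t with
  | zero =>
    have ht' : h ≤ t := by
      unfold plus0 at ht
      split at ht <;> omega
    unfold withinSem at htr
    split at htr
    · exact h₁ _ _ htr _ ht'
    · exact h₂ _ _ htr _ ht'
    · simp at htr
  | succ n ih =>
    unfold withinSem at htr
    split at htr
    · refine h₁ _ _ htr _ ?_
      unfold plus0 at ht
      split at ht <;> omega
    · obtain ⟨tr', htr', rfl⟩ := Option.map_eq_some_iff.1 htr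
      unfold Trace.delay
      split
      · rfl
      · refine ih _ _ htr' _ ?_
        unfold plus0 at ht ⊢
        -- If `h = 0`, the bound is `0` for every window, so a delay costs nothing; otherwise the
        -- delay by one is absorbed by the step from `n` to `n + 1`.
        split at ht
        · simp_all
        · simp_all
          omega
    · simp at htr

/-- No transfer takes place from the horizon on. -/
theorem Contr.sem_horizon (c : Contr Label Party Asset TVar) (γ : VEnv) (ρ : Env Label)
    (δ : TEnv TVar) (tr : Trace Party Asset) (htr : c.sem γ ρ δ = some tr) (t : ℕ)
    (ht : c.horizon δ ≤ t) : tr t = 0 := by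
  induction c generalizing γ ρ tr t with
  | zero =>
    obtain rfl : 0 = tr := by simpa [Contr.sem] using htr
    rfl
  | letin x e c ih =>
    obtain ⟨v, _, h⟩ := Option.bind_eq_some_iff.1 htr
    exact ih _ _ _ h _ ht
  | transfer p q a =>
    obtain rfl : Trace.now (Transfers.single p q a) = tr := by simpa [Contr.sem] using htr
    have : t ≠ 0 := Nat.one_le_iff_ne_zero.1 ht
    simp [Trace.now, this]
  | scale e c ih =>
    unfold Contr.sem at htr
    split at htr
    · obtain ⟨tr', h, rfl⟩ := Option.map_eq_some_iff.1 htr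
      simp [ih _ _ _ h _ ht]
    · simp at htr
  | translate s c ih =>
    obtain ⟨tr', h, rfl⟩ := Option.map_eq_some_iff.1 htr
    unfold Trace.delay
    split
    · rfl
    · refine ih _ _ _ h _ ?_
      simp only [Contr.horizon, plus0] at ht
      split at ht <;> omega
  | both c₁ c₂ ih₁ ih₂ =>
    obtain ⟨tr₁, h₁, h⟩ := Option.bind_eq_some_iff.1 htr
    obtain ⟨tr₂, h₂, rfl⟩ := Option.map_eq_some_iff.1 h
    have := max_le_iff.1 ht
    simp [ih₁ _ _ _ h₁ _ this.1, ih₂ _ _ _ h₂ _ this.2]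
  | ifWithin e s c₁ c₂ ih₁ ih₂ =>
    exact withinSem_horizon (fun ρ tr h t ht => ih₁ _ _ _ h _ (le_of_max_le_left ht))
      (fun ρ tr h t ht => ih₂ _ _ _ h _ (le_of_max_le_right ht)) _ _ _ htr _ ht

/-! ### Finiteness in the assets. -/

/-- Every transfer of the trace involves finitely many assets. -/
def Trace.FiniteAssets (tr : Trace Party Asset) : Prop :=
  ∀ t p q, (Function.support (tr t p q)).Finite

theorem Trace.FiniteAssets.delay {tr : Trace Party Asset} (h : tr.FiniteAssets) (n : ℕ) :
    Trace.FiniteAssets (Trace.delay n tr) := by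
  intro t p q
  unfold Trace.delay
  split
  · simp
  · exact h _ p q

theorem Trace.finiteAssets_now_single (p q : Party) (a : Asset) :
    Trace.FiniteAssets (Trace.now (Transfers.single p q a)) := by
  intro t p' q'
  refine (Set.finite_singleton a).subset fun a' ha' => ?_
  by_contra hne
  apply ha'
  have hne : a' ≠ a := hne
  unfold Trace.now
  split <;> simp [Transfers.single, hne]

theorem withinSem_finiteAssets {b : Env Label → Option Val}
    {k₁ k₂ : Env Label → Option (Trace Party Asset)}
    (h₁ : ∀ ρ tr, k₁ ρ = some tr → tr.FiniteAssets)
    (h₂ : ∀ ρ tr, k₂ ρ = some tr → tr.FiniteAssets) (n : ℕ) (ρ : Env Label)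
    (tr : Trace Party Asset) (htr : withinSem b k₁ k₂ n ρ = some tr) : tr.FiniteAssets := by
  induction n generalizing ρ tr with
  | zero =>
    unfold withinSem at htr
    split at htr
    · exact h₁ _ _ htr
    · exact h₂ _ _ htr
    · simp at htr
  | succ n ih =>
    unfold withinSem at htr
    split at htr
    · exact h₁ _ _ htr
    · obtain ⟨tr', htr', rfl⟩ := Option.map_eq_some_iff.1 htr
      exact (ih _ _ htr').delay 1
    · simp at htr

/-- `Transfers.total` is a `finsum`, which is `0` by convention on infinite supports and so is not
additive in general. Finite supports make it additive for `both`. -/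
theorem Contr.sem_finiteAssets (c : Contr Label Party Asset TVar) (γ : VEnv) (ρ : Env Label)
    (δ : TEnv TVar) (tr : Trace Party Asset) (htr : c.sem γ ρ δ = some tr) :
    tr.FiniteAssets := by
  induction c generalizing γ ρ tr with
  | zero =>
    obtain rfl : 0 = tr := by simpa [Contr.sem] using htr
    intro t p q
    simp
  | letin x e c ih =>
    obtain ⟨v, _, h⟩ := Option.bind_eq_some_iff.1 htr
    exact ih _ _ _ h
  | transfer p q a =>
    obtain rfl : Trace.now (Transfers.single p q a) = tr := by simpa [Contr.sem] using htr
    exact Trace.finiteAssets_now_single p q a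
  | scale e c ih =>
    unfold Contr.sem at htr
    split at htr
    · next r _ =>
      obtain ⟨tr', h, rfl⟩ := Option.map_eq_some_iff.1 htr
      exact fun t p q => (ih _ _ _ h t p q).subset
        (Function.support_const_smul_subset r (tr' t p q))
    · simp at htr
  | translate s c ih =>
    obtain ⟨tr', h, rfl⟩ := Option.map_eq_some_iff.1 htr
    exact (ih _ _ _ h).delay _
  | both c₁ c₂ ih₁ ih₂ =>
    obtain ⟨tr₁, h₁, h⟩ := Option.bind_eq_some_iff.1 htr
    obtain ⟨tr₂, h₂, rfl⟩ := Option.map_eq_some_iff.1 h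
    exact fun t p q => ((ih₁ _ _ _ h₁ t p q).union (ih₂ _ _ _ h₂ t p q)).subset
      (Function.support_add _ _)
  | ifWithin e s c₁ c₂ ih₁ ih₂ =>
    exact withinSem_finiteAssets (fun ρ tr h => ih₁ _ _ _ h) (fun ρ tr h => ih₂ _ _ _ h) _ _ _ htr

/-! ### Definedness of ground contracts. -/

theorem withinSem_isSome {b : Env Label → Option Val}
    {k₁ k₂ : Env Label → Option (Trace Party Asset)}
    (hb : ∀ ρ : Env Label, ρ.WellTyped σ → ∃ v, b ρ = some v ∧ v.HasTy .bool)
    (h₁ : ∀ ρ : Env Label, ρ.WellTyped σ → ∃ tr, k₁ ρ = some tr)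
    (h₂ : ∀ ρ : Env Label, ρ.WellTyped σ → ∃ tr, k₂ ρ = some tr) (n : ℕ) {ρ : Env Label}
    (hρ : ρ.WellTyped σ) : ∃ tr, withinSem b k₁ k₂ n ρ = some tr := by
  induction n generalizing ρ with
  | zero =>
    obtain ⟨_, hv, ⟨⟩ | ⟨_ | _⟩⟩ := hb ρ hρ
    · simpa [withinSem, hv] using h₂ ρ hρ
    · simpa [withinSem, hv] using h₁ ρ hρ
  | succ n ih =>
    obtain ⟨_, hv, ⟨⟩ | ⟨_ | _⟩⟩ := hb ρ hρ
    · obtain ⟨tr, htr⟩ := ih (hρ.shift 1)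
      exact ⟨Trace.delay 1 tr, by simp only [withinSem, hv, htr, Option.map_some]⟩
    · simpa [withinSem, hv] using h₁ ρ hρ

theorem Contr.Ground.sem {c : Contr Label Party Asset TVar} (h : c.Ground σ) (γ : VEnv)
    (δ : TEnv TVar) {ρ : Env Label} (hρ : ρ.WellTyped σ) : ∃ tr, c.sem γ ρ δ = some tr := by
  induction h generalizing ρ with
  | zero => exact ⟨_, rfl⟩
  | transfer p q a => exact ⟨_, rfl⟩
  | scale he _ ih =>
    obtain ⟨_, hv, ⟨r⟩⟩ := he.sem γ hρ
    obtain ⟨tr, htr⟩ := ih hρ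
    exact ⟨r • tr, by simp only [Contr.sem, hv, htr, Option.map_some]⟩
  | translate t _ ih =>
    obtain ⟨tr, htr⟩ := ih (hρ.shift (t.sem δ))
    exact ⟨Trace.delay (t.sem δ) tr, by simp only [Contr.sem, htr, Option.map_some]⟩
  | both _ _ ih₁ ih₂ =>
    obtain ⟨tr₁, h₁⟩ := ih₁ hρ
    obtain ⟨tr₂, h₂⟩ := ih₂ hρ
    exact ⟨tr₁ + tr₂, by simp only [Contr.sem, h₁, h₂, Option.bind_some, Option.map_some]⟩
  | ifWithin t he _ _ ih₁ ih₂ =>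
    exact withinSem_isSome (fun ρ h => he.sem γ h) (fun ρ h => ih₁ h) (fun ρ h => ih₂ h) _ hρ

/-! ## Reduction -/

/-- Reduction drops the first entry of the trace. -/
theorem Red.sound {γ₀ : VEnv} {ρ : PEnv Label} {c c' : Contr Label Party Asset TVar}
    {T : Transfers Party Asset} (hred : Red γ₀ ρ c T c') (hc : c.Ground σ) (γ : VEnv)
    (δ : TEnv TVar) {ρ' : Env Label} (hρ' : ρ'.WellTyped σ) (hρ : ρ'.Extends ρ)
    {tr : Trace Party Asset} (htr : c.sem γ ρ' δ = some tr) :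
    c'.Ground σ ∧ c'.sem γ (shift 1 ρ') δ = some (fun t => tr (t + 1)) := by
  induction hred generalizing tr with
  | zero γ₀ ρ =>
    obtain rfl : 0 = tr := by simpa [Contr.sem] using htr
    exact ⟨.zero, rfl⟩
  | letin _ _ => cases hc
  | transfer γ₀ ρ p q a =>
    obtain rfl : Trace.now (Transfers.single p q a) = tr := by simpa [Contr.sem] using htr
    exact ⟨.zero, rfl⟩
  | scale _ _ ih =>
    cases hc with
    | scale he hc =>
      have hs := he.specialise γ ‹_› hρ' hρ
      -- The offset `-1` cancels the advance of the environment by `1`: the scaling factor keeps the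
      -- value it had before the step.
      have hp := hs.1.sem_promote (-1) γ (shift 1 ρ')
      rw [shift_shift, neg_add_cancel, shift_zero, hs.2] at hp
      obtain ⟨_, hv, ⟨r⟩⟩ := he.sem γ hρ'
      simp only [Contr.sem, hv, Option.map_eq_some_iff] at htr
      obtain ⟨tr, htr, rfl⟩ := htr
      obtain ⟨hg, h⟩ := ih hc hρ htr
      refine ⟨.scale (hs.1.promote _) hg, ?_⟩
      simp only [Contr.sem, hp, hv, h, Option.map_some]
      rfl
  -- Whether the factor is known affects only the emitted transfer, not the remaining trace, so the
  -- argument is the same as for a known factor.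
  | scale_unknown _ _ ih =>
    cases hc with
    | scale he hc =>
      have hs := he.specialise γ ‹_› hρ' hρ
      have hp := hs.1.sem_promote (-1) γ (shift 1 ρ')
      rw [shift_shift, neg_add_cancel, shift_zero, hs.2] at hp
      obtain ⟨_, hv, ⟨r⟩⟩ := he.sem γ hρ'
      simp only [Contr.sem, hv, Option.map_eq_some_iff] at htr
      obtain ⟨tr, htr, rfl⟩ := htr
      obtain ⟨hg, h⟩ := ih hc hρ htr
      refine ⟨.scale (hs.1.promote _) hg, ?_⟩
      simp only [Contr.sem, hp, hv, h, Option.map_some]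
      rfl
  | translate_zero _ ih =>
    cases hc with
    | translate _ hc =>
      obtain ⟨tr', h, rfl⟩ := Option.map_eq_some_iff.1 htr
      simp only [TExpr.sem, Nat.cast_zero, shift_zero] at h
      simpa only [TExpr.sem, Trace.delay_zero] using ih hc hρ h
  | translate_succ γ₀ ρ n c =>
    cases hc with
    | translate _ hc =>
      obtain ⟨tr', h, rfl⟩ := Option.map_eq_some_iff.1 htr
      refine ⟨.translate _ hc, ?_⟩
      simp only [TExpr.sem, Nat.cast_add, Nat.cast_one] at h
      simp only [Contr.sem, TExpr.sem, shift_shift, h, Option.map_some, Option.some.injEq]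
      funext t
      simp [Trace.delay]
  | both _ _ ih₁ ih₂ =>
    cases hc with
    | both hc₁ hc₂ =>
      obtain ⟨tr₁, h₁, h⟩ := Option.bind_eq_some_iff.1 htr
      obtain ⟨tr₂, h₂, rfl⟩ := Option.map_eq_some_iff.1 h
      obtain ⟨hg₁, h₁⟩ := ih₁ hc₁ hρ h₁
      obtain ⟨hg₂, h₂⟩ := ih₂ hc₂ hρ h₂
      refine ⟨.both hg₁ hg₂, ?_⟩
      simp only [Contr.sem, h₁, h₂, Option.bind_some, Option.map_some]
      rfl
  | @if_true γ₀ ρ e n c₁ c₁' c₂ T hl _ ih =>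
    cases hc with
    | ifWithin _ he hc₁ hc₂ =>
      have hs : e.sem γ ρ' = _ :=
        (he.specialise γ γ₀ hρ' hρ).2.symm.trans (Exp.sem_of_lit? hl γ ρ')
      refine ih hc₁ hρ ?_
      -- `withinSem` unfolds only once the window is zero or a successor; when the condition is true
      -- the two equations agree.
      cases n <;> simpa only [Contr.sem, TExpr.sem, withinSem, hs] using htr
  | @if_false_zero γ₀ ρ e c₁ c₂ c₂' T hl _ ih =>
    cases hc with
    | ifWithin _ he hc₁ hc₂ =>
      have hs : e.sem γ ρ' = _ :=
        (he.specialise γ γ₀ hρ' hρ).2.symm.trans (Exp.sem_of_lit? hl γ ρ')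
      refine ih hc₂ hρ ?_
      simpa only [Contr.sem, TExpr.sem, withinSem, hs] using htr
  | @if_false_succ γ₀ ρ e n c₁ c₂ hl =>
    cases hc with
    | ifWithin _ he hc₁ hc₂ =>
      have hs : e.sem γ ρ' = _ :=
        (he.specialise γ γ₀ hρ' hρ).2.symm.trans (Exp.sem_of_lit? hl γ ρ')
      refine ⟨.ifWithin _ he hc₁ hc₂, ?_⟩
      simp only [Contr.sem, TExpr.sem, withinSem, hs, Option.map_eq_some_iff] at htr
      obtain ⟨tr, htr, rfl⟩ := htr
      simp only [Contr.sem, TExpr.sem, htr, Trace.delay_add]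

/-- `n` reduction steps drop the first `n` entries of the trace. -/
theorem RedN.sound {γ₀ : VEnv} {ρs : ℕ → PEnv Label} {c c' : Contr Label Party Asset TVar} {n : ℕ}
    (hred : RedN γ₀ ρs c n c') (hc : c.Ground σ) (γ : VEnv)
    (δ : TEnv TVar) {ρ' : Env Label} (hρ' : ρ'.WellTyped σ)
    (hρ : ∀ i < n, Env.Extends (shift i ρ') (ρs i))
    {tr : Trace Party Asset} (htr : c.sem γ ρ' δ = some tr) :
    c'.Ground σ ∧ c'.sem γ (shift n ρ') δ = some (fun t => tr (t + n)) := by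
  induction hred with
  | refl => exact ⟨hc, by simpa [shift_zero] using htr⟩
  | @step n _ _ _ _ hstep ih =>
    obtain ⟨hg, h⟩ := ih fun i hi => hρ i (by omega)
    have := hstep.sound hg γ δ (hρ'.shift n) (hρ n (by omega)) h
    rw [shift_shift] at this
    simpa only [Nat.cast_add, Nat.cast_one, add_assoc, add_comm, add_left_comm] using this

/-! ## Compilation -/

theorem smartTplus_sem (δ : TEnv TVar) (t₁ t₂ : ILTExpr TVar) :
    (smartTplus t₁ t₂).sem δ = t₁.sem δ + t₂.sem δ := by
  unfold smartTplus
  split <;> rfl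

/-- Two clocks add up: the starting time `t₀`, fixed at compilation and advanced by `translate`, and
the shift `s`, advanced at run time by `loopif`. The current time `n` plays no role, as compiled
expressions contain neither `now` nor payoffs. -/
theorem Exp.GroundTy.compile_sound {e : Exp Label} {τ : Ty} (h : e.GroundTy σ τ) (γ : VEnv)
    (δ : TEnv TVar) {ρ : Env Label} (hρ : ρ.WellTyped σ) {t₀ : ILTExpr TVar}
    {il : ILExpr Label Party TVar} (hil : e.compile Party t₀ = some il) (s n : ℕ) (d : ℕ → ℝ)
    (p₁ p₂ : Party) :
    il.cutPayoff.sem ρ δ s n d p₁ p₂ =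
      (e.sem γ (shift ((t₀.sem δ + s : ℕ) : ℤ) ρ)).map .val := by
  induction h generalizing il with
  | obs l i =>
    obtain rfl := Option.some.inj hil
    simp [ILExpr.cutPayoff, ILExpr.sem, Exp.sem, shift, ILTExprZ.sem]
    ring_nf
  | real r =>
    obtain rfl := Option.some.inj hil
    rfl
  | bool b =>
    obtain rfl := Option.some.inj hil
    rfl
  | un ho he ih =>
    simp only [Exp.compile, Option.map_eq_some_iff] at hil
    obtain ⟨_, h, rfl⟩ := hil
    obtain ⟨v, hv, _⟩ := he.sem γ (hρ.shift ((t₀.sem δ + s : ℕ) : ℤ))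
    simp only [ILExpr.cutPayoff, ILExpr.sem, Exp.sem, ih h, hv, UnOp.ilSem, Option.map_some,
      Option.bind_some]
  | bin ho he₁ he₂ ih₁ ih₂ =>
    simp only [Exp.compile, Option.map_eq_some_iff, Option.bind_eq_some_iff] at hil
    obtain ⟨_, h₁, _, h₂, rfl⟩ := hil
    obtain ⟨v₁, hv₁, _⟩ := he₁.sem γ (hρ.shift ((t₀.sem δ + s : ℕ) : ℤ))
    obtain ⟨v₂, hv₂, _⟩ := he₂.sem γ (hρ.shift ((t₀.sem δ + s : ℕ) : ℤ))
    simp only [ILExpr.cutPayoff, ILExpr.sem, Exp.sem, ih₁ h₁, ih₂ h₂, hv₁, hv₂, BinOp.ilSem,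
      Option.map_some, Option.bind_some]
  | cond he he₁ he₂ ih ih₁ ih₂ =>
    simp only [Exp.compile, Option.map_eq_some_iff, Option.bind_eq_some_iff] at hil
    obtain ⟨_, h, _, h₁, _, h₂, rfl⟩ := hil
    -- `cond` evaluates both branches whereas `ite` evaluates only one; they agree because both
    -- branches are defined.
    obtain ⟨v, hv, ⟨⟩ | ⟨b⟩⟩ := he.sem γ (hρ.shift ((t₀.sem δ + s : ℕ) : ℤ))
    obtain ⟨v₁, hv₁, ht₁⟩ := he₁.sem γ (hρ.shift ((t₀.sem δ + s : ℕ) : ℤ))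
    obtain ⟨v₂, hv₂, ht₂⟩ := he₂.sem γ (hρ.shift ((t₀.sem δ + s : ℕ) : ℤ))
    simp only [ILExpr.cutPayoff, ILExpr.sem, Exp.sem, ih h, ih₁ h₁, ih₂ h₂, hv, hv₁, hv₂,
      Option.map_some, Option.bind_some, condSem_of_hasTy b ht₁ ht₂]
    cases b <;> rfl

/-! ### Discounted value of a trace. -/

/-- `v` is the value at time `n`, discounted by `d`, of the transfers from `p₁` to `p₂` in the
trace `tr` started at time `k`, ignoring those before time `n`. -/
def Trace.HasValue (tr : Trace Party Asset) (d : ℕ → ℝ) (n : ℕ) (p₁ p₂ : Party) (k : ℕ)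
    (v : ℝ) : Prop :=
  HasSum (fun t => if t + k < n then 0 else d (t + k) * (tr t).total p₁ p₂) v

section HasValue

variable {d : ℕ → ℝ} {n : ℕ} {p₁ p₂ : Party}

theorem Trace.hasValue_zero (k : ℕ) :
    Trace.HasValue (0 : Trace Party Asset) d n p₁ p₂ k 0 := by
  simp [Trace.HasValue, Transfers.total, hasSum_zero]

theorem Trace.HasValue.smul {tr : Trace Party Asset} {k : ℕ} {v : ℝ}
    (h : tr.HasValue d n p₁ p₂ k v) (r : ℝ) : Trace.HasValue (r • tr) d n p₁ p₂ k (r * v) := by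
  unfold Trace.HasValue
  refine Eq.mp (congrArg (HasSum · _) (funext fun t => ?_)) (HasSum.mul_left r h)
  -- No finite support is needed here: a nonzero factor preserves the support, and a zero factor
  -- makes both sides `0`.
  have : ((r • tr) t).total p₁ p₂ = r * (tr t).total p₁ p₂ :=
    (smul_finsum r fun a => tr t p₁ p₂ a).symm
  rw [this]
  split <;> ring

theorem Trace.HasValue.add {tr₁ tr₂ : Trace Party Asset} {k : ℕ} {v₁ v₂ : ℝ}
    (hf₁ : tr₁.FiniteAssets) (hf₂ : tr₂.FiniteAssets)
    (h₁ : tr₁.HasValue d n p₁ p₂ k v₁) (h₂ : tr₂.HasValue d n p₁ p₂ k v₂) :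
    Trace.HasValue (tr₁ + tr₂) d n p₁ p₂ k (v₁ + v₂) := by
  unfold Trace.HasValue
  convert HasSum.add h₁ h₂ using 2 with t
  have : ((tr₁ + tr₂) t).total p₁ p₂ = (tr₁ t).total p₁ p₂ + (tr₂ t).total p₁ p₂ :=
    finsum_add_distrib (hf₁ t p₁ p₂) (hf₂ t p₁ p₂)
  rw [this]
  split <;> ring

theorem Trace.HasValue.delay {tr : Trace Party Asset} {m k : ℕ} {v : ℝ}
    (h : tr.HasValue d n p₁ p₂ (k + m) v) :
    Trace.HasValue (Trace.delay m tr) d n p₁ p₂ k v := by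
  unfold Trace.HasValue
  -- The first `m` terms of the delayed series vanish, and what remains is the series of `tr`
  -- started at `k + m`.
  rw [← hasSum_nat_add_iff' m, Finset.sum_eq_zero, sub_zero]
  · simpa only [Trace.delay_add, Trace.HasValue, add_assoc, add_comm m k] using h
  · intro t ht
    simp [Trace.delay, Finset.mem_range.1 ht, Transfers.total]

/-- Only the asset `a` contributes. If `p = q` there is no transfer, and neither condition on the
right can hold, as it would force `p₁ = p₂`. -/
theorem Transfers.total_single (hp : p₁ ≠ p₂) (p q : Party) (a : Asset) [DecidableEq Party] :
    (Transfers.single p q a).total p₁ p₂ =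
      if p = p₁ ∧ q = p₂ then 1 else if p = p₂ ∧ q = p₁ then -1 else 0 := by
  classical
  have h : ∀ a', Transfers.single p q a p₁ p₂ a' = if a' = a then
      (if p = p₁ ∧ q = p₂ then 1 else if p = p₂ ∧ q = p₁ then -1 else 0) else (0 : ℝ) := by
    intro a'
    unfold Transfers.single
    grind
  unfold Transfers.total
  rw [finsum_eq_single _ a fun a' ha' => by rw [h, if_neg ha'], h, if_pos rfl]

end HasValue

/-- Both recursions consume the window in lockstep: where `withinSem` advances the environment and
delays the trace by one, `loopSem` increments `s`, which moves the absolute start `k + s` by the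
same amount. The branches must therefore be understood at every `s`. -/
theorem loopSem_hasValue {k n : ℕ}
    {d : ℕ → ℝ} {p₁ p₂ : Party} {b : Env Label → Option Val}
    {k₁ k₂ : Env Label → Option (Trace Party Asset)} {l l₁ l₂ : ℕ → Option ILVal}
    {ρ : Env Label}
    (hb : ∀ s : ℕ, l s = (b (shift ((k + s : ℕ) : ℤ) ρ)).map .val)
    (h₁ : ∀ (s : ℕ) tr, k₁ (shift ((k + s : ℕ) : ℤ) ρ) = some tr →
      ∃ v, l₁ s = some (.val (.real v)) ∧ tr.HasValue d n p₁ p₂ (k + s) v)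
    (h₂ : ∀ (s : ℕ) tr, k₂ (shift ((k + s : ℕ) : ℤ) ρ) = some tr →
      ∃ v, l₂ s = some (.val (.real v)) ∧ tr.HasValue d n p₁ p₂ (k + s) v)
    (m s : ℕ) (tr : Trace Party Asset)
    (htr : withinSem b k₁ k₂ m (shift ((k + s : ℕ) : ℤ) ρ) = some tr) :
    ∃ v, loopSem l l₁ l₂ m s = some (.val (.real v)) ∧ tr.HasValue d n p₁ p₂ (k + s) v := by
  induction m generalizing s tr with
  | zero =>
    unfold withinSem at htr
    split at htr
    · next h => simpa only [loopSem, hb, h, Option.map_some] using h₁ s tr htr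
    · next h => simpa only [loopSem, hb, h, Option.map_some] using h₂ s tr htr
    · simp at htr
  | succ m ih =>
    unfold withinSem at htr
    split at htr
    · next h => simpa only [loopSem, hb, h, Option.map_some] using h₁ s tr htr
    · next h =>
      obtain ⟨tr', htr', rfl⟩ := Option.map_eq_some_iff.1 htr
      have hs : (1 : ℤ) + ((k + s : ℕ) : ℤ) = ((k + (s + 1) : ℕ) : ℤ) := by push_cast; ring
      rw [shift_shift, hs] at htr'
      obtain ⟨v, hv, hval⟩ := ih _ _ htr'
      exact ⟨v, by simpa only [loopSem, hb, h, Option.map_some] using hv,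
        Trace.HasValue.delay (by rwa [add_assoc])⟩
    · simp at htr

/-- The compiled contract computes the value of the trace. -/
theorem Contr.Ground.compile_sound {c : Contr Label Party Asset TVar} (hc : c.Ground σ) (γ : VEnv)
    (δ : TEnv TVar) {ρ : Env Label} (hρ : ρ.WellTyped σ) {t₀ : ILTExpr TVar}
    {il : ILExpr Label Party TVar} (hil : c.compile t₀ = some il) (n : ℕ) (d : ℕ → ℝ)
    {p₁ p₂ : Party} (hp : p₁ ≠ p₂) (s : ℕ) (tr : Trace Party Asset)
    (htr : c.sem γ (shift ((t₀.sem δ + s : ℕ) : ℤ) ρ) δ = some tr) :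
    ∃ v, il.cutPayoff.sem ρ δ s n d p₁ p₂ = some (.val (.real v)) ∧
      tr.HasValue d n p₁ p₂ (t₀.sem δ + s) v := by
  induction hc generalizing t₀ il s tr with
  | zero =>
    obtain rfl := Option.some.inj hil
    obtain rfl := Option.some.inj htr
    exact ⟨0, rfl, Trace.hasValue_zero _⟩
  | transfer p q a =>
    classical
    obtain rfl := Option.some.inj hil
    obtain rfl := Option.some.inj htr
    -- Only time `0` of the trace contributes, at absolute time `t₀ + s`; the guard inserted by
    -- `cutPayoff` is exactly the comparison with `n`.
    refine ⟨if t₀.sem δ + s < n then 0 else d (t₀.sem δ + s) *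
      (Transfers.single p q a).total p₁ p₂, ?_, ?_⟩
    · rw [Transfers.total_single hp]
      by_cases h : t₀.sem δ + s < n
      · simp [ILExpr.cutPayoff, ILExpr.sem, BinOp.ilSem, h]
      · simp [ILExpr.cutPayoff, ILExpr.sem, BinOp.ilSem, h]
    · unfold Trace.HasValue
      convert hasSum_single (f := fun t => if t + (t₀.sem δ + s) < n then 0 else
        d (t + (t₀.sem δ + s)) * ((Trace.now (Transfers.single p q a)) t).total p₁ p₂) 0 ?_ using 1
      · simp [Trace.now]
      · intro t ht
        simp [Trace.now, ht, Transfers.total]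
  | scale he _ ih =>
    simp only [Contr.compile, Option.map_eq_some_iff, Option.bind_eq_some_iff] at hil
    obtain ⟨_, h₁, _, h₂, rfl⟩ := hil
    obtain ⟨_, hr, ⟨r⟩⟩ := he.sem γ (hρ.shift ((t₀.sem δ + s : ℕ) : ℤ))
    simp only [Contr.sem, hr, Option.map_eq_some_iff] at htr
    obtain ⟨tr, htr, rfl⟩ := htr
    obtain ⟨v, hv, hval⟩ := ih h₂ _ _ htr
    refine ⟨r * v, ?_, hval.smul r⟩
    simp only [ILExpr.cutPayoff, ILExpr.sem, he.compile_sound γ δ hρ h₁, hr, hv, BinOp.ilSem,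
      BinOp.sem, Option.map_some, Option.bind_some]
  | translate t _ ih =>
    obtain ⟨tr', htr', rfl⟩ := Option.map_eq_some_iff.1 htr
    -- The delay is moved into the compile-time start, leaving `s` unchanged.
    have hs : ((t.sem δ : ℕ) : ℤ) + ((t₀.sem δ + s : ℕ) : ℤ) =
        (((smartTplus t₀ (.texpr t)).sem δ + s : ℕ) : ℤ) := by
      rw [smartTplus_sem]
      simp only [ILTExpr.sem]
      push_cast
      ring
    rw [shift_shift, hs] at htr'
    obtain ⟨v, hv, hval⟩ := ih hil _ _ htr'
    refine ⟨v, hv, Trace.HasValue.delay ?_⟩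
    rw [smartTplus_sem] at hval
    simpa only [ILTExpr.sem, add_right_comm] using hval
  | both _ _ ih₁ ih₂ =>
    simp only [Contr.compile, Option.map_eq_some_iff, Option.bind_eq_some_iff] at hil
    obtain ⟨_, h₁, _, h₂, rfl⟩ := hil
    obtain ⟨tr₁, htr₁, h⟩ := Option.bind_eq_some_iff.1 htr
    obtain ⟨tr₂, htr₂, rfl⟩ := Option.map_eq_some_iff.1 h
    obtain ⟨v₁, hv₁, hval₁⟩ := ih₁ h₁ _ _ htr₁
    obtain ⟨v₂, hv₂, hval₂⟩ := ih₂ h₂ _ _ htr₂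
    refine ⟨v₁ + v₂, ?_, hval₁.add (Contr.sem_finiteAssets _ _ _ _ _ htr₁)
      (Contr.sem_finiteAssets _ _ _ _ _ htr₂) hval₂⟩
    simp [ILExpr.cutPayoff, ILExpr.sem, hv₁, hv₂, BinOp.ilSem, BinOp.sem]
  | ifWithin t he _ _ ih₁ ih₂ =>
    simp only [Contr.compile, Option.map_eq_some_iff, Option.bind_eq_some_iff] at hil
    obtain ⟨_, h, _, h₁, _, h₂, rfl⟩ := hil
    exact loopSem_hasValue (fun s => he.compile_sound γ δ hρ h s n d p₁ p₂)
      (fun s tr htr => ih₁ h₁ s tr htr) (fun s tr htr => ih₂ h₂ s tr htr) _ _ _ htr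

/-- The guard removes precisely the `n` entries of the trace that reduction has dropped. -/
theorem RedN.cutPayoff_sem {p₁ p₂ : Party} (hp : p₁ ≠ p₂) (d : ℕ → ℝ)
    {ρ' : Env Label} (hρ' : ρ'.WellTyped σ) (δ : TEnv TVar) (γ : VEnv) {γ₀ : VEnv}
    {c c' : Contr Label Party Asset TVar} (hc : c.Ground σ)
    {il : ILExpr Label Party TVar} (hil : c.compile (.texpr (.num 0)) = some il)
    {n : ℕ} {ρs : ℕ → PEnv Label} {trace : Trace Party Asset}
    (hρ : ∀ i < n, Env.Extends (shift i ρ') (ρs i)) (hred : RedN γ₀ ρs c n c')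
    (htrace : c'.sem γ (shift n ρ') δ = some trace) :
    il.cutPayoff.sem ρ' δ 0 n d p₁ p₂ =
      some (.val (.real
        (∑ t ∈ Finset.range (c'.horizon δ + 1), d (t + n) * (trace t).total p₁ p₂))) := by
  -- The trace of the original contract comes from totality; since the semantics is a function,
  -- `trace` must be its tail.
  obtain ⟨tr, htr⟩ := hc.sem γ δ hρ'
  obtain ⟨-, h⟩ := hred.sound hc γ δ hρ' hρ htr
  obtain rfl : (fun t => tr (t + n)) = trace := by simpa [h] using htrace
  have hz : ((ILTExpr.texpr (TExpr.num 0)).sem δ + 0 : ℕ) = 0 := rfl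
  obtain ⟨v, hv, hval⟩ := hc.compile_sound γ δ hρ' hil n d hp 0 tr
    (by rwa [hz, Nat.cast_zero, shift_zero])
  rw [hv]
  congr 3
  unfold Trace.HasValue at hval
  -- Split off the first `n` terms, all zero by the guard; in the rest the guard never applies.
  rw [hz, ← hasSum_nat_add_iff' n, Finset.sum_eq_zero, sub_zero] at hval
  · refine hval.unique ?_
    simp only [add_zero, not_lt.2 (Nat.le_add_left _ _), if_false]
    -- The range includes the horizon itself, where the term is already zero.
    refine hasSum_sum_of_ne_finset_zero fun t ht => ?_
    have := c'.sem_horizon γ _ δ _ h t (by simp at ht; omega)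
    simp [this, Transfers.total]
  · intro t ht
    simp [Finset.mem_range.1 ht]

end CL

/-- Soundness of contract compilation with respect to contract reduction, for one step and for
`n` steps. -/
theorem mainTheorem4 {Label Party Asset TVar : Type*} (σ : Label → Ty)
    (p₁ p₂ : Party) (hp : p₁ ≠ p₂) (d : ℕ → ℝ)
    (ρ' : Env Label) (hρ' : ρ'.WellTyped σ) (δ : TEnv TVar)
    (Γ : TyCtx) (γ γ₀ : VEnv) (hγ : γ.WellTyped Γ) (hγ₀ : γ.Extends γ₀)
    (c : Contr Label Party Asset TVar) (hc : c.WellTyped σ Γ) (hTC : c.TemplateClosed)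
    (il : ILExpr Label Party TVar) (hil : c.compile (.texpr (.num 0)) = some il) :
    (∀ (ρ : PEnv Label) (T : Transfers Party Asset) (c' : Contr Label Party Asset TVar)
        (trace : Trace Party Asset),
      ρ'.Extends ρ → Red γ₀ ρ c T c' → c'.sem γ (shift 1 ρ') δ = some trace →
        il.cutPayoff.sem ρ' δ 0 1 d p₁ p₂ =
          some (.val (.real
            (∑ t ∈ Finset.range (c'.horizon δ + 1), d (t + 1) * (trace t).total p₁ p₂)))) ∧
    (∀ (n : ℕ) (ρs : ℕ → PEnv Label) (c' : Contr Label Party Asset TVar)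
        (trace : Trace Party Asset),
      (∀ i < n, Env.Extends (shift i ρ') (ρs i)) → RedN γ₀ ρs c n c' →
        c'.sem γ (shift n ρ') δ = some trace →
        il.cutPayoff.sem ρ' δ 0 n d p₁ p₂ =
          some (.val (.real
            (∑ t ∈ Finset.range (c'.horizon δ + 1), d (t + n) * (trace t).total p₁ p₂)))) := by
  have hg := Contr.Ground.of_compile hc hil
  refine ⟨fun ρ T c' trace hρ hred htr => ?_, fun n ρs c' trace hρ hred htr =>
    hred.cutPayoff_sem hp d hρ' δ γ hg hil hρ htr⟩
  -- A single step is a one-step chain; only the entry of the family at index `0` is constrained, so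
  -- a constant family serves.
  refine RedN.cutPayoff_sem (n := 1) (ρs := fun _ => ρ) hp d hρ' δ γ hg hil ?_
    (.step .refl hred) (by simpa using htr)
  intro i hi
  obtain rfl : i = 0 := by omega
  simpa [shift_zero] using hρ
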